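/- **Model.** Fix a constant $q\in(1/2,1)$. Let $G=(V,E)$ be a graph on $n$ agents. The ground truth $\theta\in\{0,1\}$ is a fair coin and, given $\theta$, the agents receive independent private signals $s_v\in\{0,1\}$ with $\mathbb P(s_v=\theta)=q$. The agents act one after the other in a decision order $\sigma$ (a permutation of $V$). In the Bayesian model every agent knows $G$, $\sigma$, $q$ and the way the other agents decide; when it is its turn, the agent $v$ sees $s_v$ and the actions of those neighbours of $v$ in $G$ that precede $v$ in $\sigma$, and its action $a_v\in\{0,1\}$ is the value of $\theta$ with the larger posterior probability given this information. If both values are equally likely, the action is given by a fixed tie-breaking convention, which may be any function of $n$, $G$, $\sigma$, $v$ and the information of $v$. Put $L_\sigma(G)=\frac1n\sum_{v\in V}\mathbb P(a_v=\theta)$ and $L(G)=\max_\sigma L_\sigma(G)$. For $p\in[0,1]$ let $L(G(n,p))=\sum_{G}F(G)\,L(G)$, where $G$ runs over the graphs on $n$ labelled vertices and $F(G)$ is the probability of $G$ in the Erdős–Rényi model $G(n,p)$. **Proposition.** Let $p=p(n)\in[0,1]$ satisfy $p(n)=\frac{\omega(1)}{n}$ and $p(n)=\frac{o(n)}{n}$,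 that is, $n\,p(n)\to\infty$ and $n\,p(n)=o(n)$ as $n\to\infty$. Then the family of Erdős–Rényi graphs $G(n,p(n))$ achieves asymptotic truth learning under the Bayesian model: for every $q\in(1/2,1)$ and every tie-breaking convention, $$\lim_{n\to\infty}L(G(n,p(n)))=1 .$$ -/

import Mathlib

open Filter Topology Asymptotics

noncomputable section

namespace SocialLearning

/-- A state of the world for `n` agents: the ground truth `θ` (first component) together with the
private signals `s v` of all agents (second component). -/
abbrev World (n : ℕ) : Type := Bool × (Fin n → Bool)

/-- The probability of a state of the world: `θ` is a fair coin and, given `θ`, the private signals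
are independent and each of them equals `θ` with probability `q`. -/
def worldWeight (q : ℝ) {n : ℕ} (ω : World n) : ℝ :=
  1 / 2 * ∏ v : Fin n, if ω.2 v = ω.1 then q else 1 - q

/-- The probability of an event. -/
def prob (q : ℝ) {n : ℕ} (E : Set (World n)) : ℝ :=
  ∑ ω : World n, E.indicator (worldWeight q) ω

/-- The posterior probability `ℙ(θ = b | X = i)`, where `X` is a function of the private signals.
If `X = i` has probability zero, this is `0` for both values of `b`. -/
def posterior (q : ℝ) {n : ℕ} {I : Type} (X : (Fin n → Bool) → I) (i : I) (b : Bool) : ℝ :=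
  prob q {ω : World n | ω.1 = b ∧ X ω.2 = i} / prob q {ω : World n | X ω.2 = i}

/-- The optimal (Bayesian) guess of `θ` on the information `X = i`: the value with the larger
posterior probability; when both values are equally likely, the guess is `t`. -/
def bayesGuess (q : ℝ) {n : ℕ} {I : Type} (X : (Fin n → Bool) → I) (i : I) (t : Bool) : Bool :=
  if posterior q X i false < posterior q X i true then true
  else if posterior q X i true < posterior q X i false then false
  else t

variable {n : ℕ}

/-- The neighbours of `v` that decide before `v`. Here `σ u` is the position of the agent `u` in the
decision order. -/
abbrev EarlierNbr (G : SimpleGraph (Fin n)) (σ : Equiv.Perm (Fin n)) (v : Fin n) : Type :=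
  {u : Fin n // G.Adj v u ∧ σ u < σ v}

/-- What the agent `v` sees before its decision: its own private signal and the actions of its
earlier neighbours. -/
abbrev Info (G : SimpleGraph (Fin n)) (σ : Equiv.Perm (Fin n)) (v : Fin n) : Type :=
  Bool × (EarlierNbr G σ v → Bool)

/-- A tie-breaking convention on `n` agents: the guess that an agent makes when, on its information,
both values of the ground truth are equally likely. It may depend on the graph, on the decision
order, on the agent and on its information. -/
abbrev TieBreak (n : ℕ) : Type :=
  ∀ (G : SimpleGraph (Fin n)) (σ : Equiv.Perm (Fin n)) (v : Fin n), Info G σ v → Bool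

/-- The action of the agent `v` under the Bayesian model, when the private signals are `s`. The
agents decide in the order `σ`; each of them knows `G`, `σ`, `q` and the way the others decide, and
makes the Bayesian guess on the information it sees. -/
def action (q : ℝ) (τ : TieBreak n) (G : SimpleGraph (Fin n)) (σ : Equiv.Perm (Fin n))
    (v : Fin n) (s : Fin n → Bool) : Bool :=
  bayesGuess q
    (fun s' : Fin n → Bool =>
      ((s' v, fun u : EarlierNbr G σ v => action q τ G σ u.1 s') : Info G σ v))
    (s v, fun u : EarlierNbr G σ v => action q τ G σ u.1 s)
    (τ G σ v (s v, fun u : EarlierNbr G σ v => action q τ G σ u.1 s))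
termination_by (σ v).val
decreasing_by all_goals exact u.2.2

/-- The learning quality `ℓ(v)` of an agent: the probability that its action is correct. -/
def agentQuality (q : ℝ) (τ : TieBreak n) (G : SimpleGraph (Fin n)) (σ : Equiv.Perm (Fin n))
    (v : Fin n) : ℝ :=
  prob q {ω : World n | action q τ G σ v ω.2 = ω.1}

/-- The learning quality `L_σ(G)` of the network. -/
def networkQuality (q : ℝ) (τ : TieBreak n) (G : SimpleGraph (Fin n)) (σ : Equiv.Perm (Fin n)) :
    ℝ :=
  (1 / (n : ℝ)) * ∑ v : Fin n, agentQuality q τ G σ v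

/-- The learning quality of the network `G` under an optimal decision order for `G`. -/
def optimalQuality (q : ℝ) (τ : TieBreak n) (G : SimpleGraph (Fin n)) : ℝ :=
  ⨆ σ : Equiv.Perm (Fin n), networkQuality q τ G σ

/-- The learning quality of the Erdős–Rényi model `G(n, p)`: the expectation, over the random graph,
of the learning quality under a decision order that is optimal for the graph. -/
def erdosRenyiQuality (q : ℝ) (τ : TieBreak n) (p : unitInterval) : ℝ :=
  ∑ G : SimpleGraph (Fin n), (SimpleGraph.binomialRandom (Fin n) p).real {G} * optimalQuality q τ G

/-- The family of Erdős–Rényi graphs `G(n, p n)` achieves asymptotic truth learning under the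
Bayesian model with private signals of accuracy `q`, whatever the tie-breaking convention. -/
def AchievesTruthLearning (q : ℝ) (p : ℕ → unitInterval) : Prop :=
  ∀ τ : (n : ℕ) → TieBreak n, Tendsto (fun n : ℕ => erdosRenyiQuality q (τ n) (p n)) atTop (𝓝 1)

end SocialLearning

end

noncomputable section

namespace SocialLearning

variable {n : ℕ}

/-! Reserve a set `U` of `o(n)` vertices, split into `K` blocks of about `L / p` vertices, with `K`
and `L` large constants. A typical vertex outside `U` has a neighbour in every block, and since `p →
0` its neighbours in `U` are independent. Since `n p → ∞`, two disjoint sets of `ε n` vertices are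
joined by an edge with high probability, so deleting `U` leaves a component with almost all
vertices, and it contains such a typical vertex `v`. Let `K` independent neighbours of `v` in `U`
decide first. They act on their own signals, so `v` could follow their majority and errs with
probability at most `(1/2 + 2q(1-q))^K`. The component then decides by increasing distance from `v`;
each agent could copy a neighbour closer to `v`, so the quality never drops. Both comparisons use
only that a Bayesian guess beats every other guess on the same information
(`prob_le_prob_bayesGuess`), hence tie-breaking is irrelevant. The order is built in
`exists_order_le_agentQuality`, the component in `exists_subset_reachable`. -/

/-! ### The probability space of truth and signals -/

theorem worldWeight_nonneg {q : ℝ} (hq0 : 0 ≤ q) (hq1 : q ≤ 1) (ω : World n) :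
    0 ≤ worldWeight q ω := by
  unfold worldWeight
  refine mul_nonneg (by norm_num) (Finset.prod_nonneg fun v _ => ?_)
  split_ifs <;> linarith

/-- The expectation of a product of functions of the single signals. -/
theorem sum_worldWeight_mul_prod (q : ℝ) (g : Bool → Fin n → Bool → ℝ) :
    ∑ ω : World n, worldWeight q ω * ∏ v, g ω.1 v (ω.2 v) =
      1 / 2 * ∑ b, ∏ v, (q * g b v b + (1 - q) * g b v (!b)) := by
  rw [Fintype.sum_prod_type, Finset.mul_sum]
  refine Finset.sum_congr rfl fun b _ => ?_
  have h : ∀ v, q * g b v b + (1 - q) * g b v (!b) =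
      ∑ s : Bool, (if s = b then q else 1 - q) * g b v s := by
    intro v
    cases b <;> simp [add_comm]
  simp_rw [h]
  rw [Finset.prod_univ_sum, Fintype.piFinset_univ, Finset.mul_sum]
  refine Finset.sum_congr rfl fun s _ => ?_
  rw [worldWeight, mul_assoc, ← Finset.prod_mul_distrib]

theorem sum_worldWeight (q : ℝ) : ∑ ω : World n, worldWeight q ω = 1 := by
  have h := sum_worldWeight_mul_prod (n := n) q fun _ _ _ => 1
  simpa using h

theorem prob_nonneg {q : ℝ} (hq0 : 0 ≤ q) (hq1 : q ≤ 1) (E : Set (World n)) : 0 ≤ prob q E :=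
  Finset.sum_nonneg fun ω _ => Set.indicator_nonneg (fun ω _ => worldWeight_nonneg hq0 hq1 ω) ω

theorem prob_mono {q : ℝ} (hq0 : 0 ≤ q) (hq1 : q ≤ 1) {E F : Set (World n)} (h : E ⊆ F) :
    prob q E ≤ prob q F :=
  Finset.sum_le_sum fun ω _ =>
    Set.indicator_le_indicator_of_subset h (worldWeight_nonneg hq0 hq1) ω

theorem prob_univ (q : ℝ) : prob q (Set.univ : Set (World n)) = 1 := by
  simp [prob, sum_worldWeight]

theorem prob_le_one {q : ℝ} (hq0 : 0 ≤ q) (hq1 : q ≤ 1) (E : Set (World n)) : prob q E ≤ 1 :=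
  (prob_mono hq0 hq1 (Set.subset_univ E)).trans_eq (prob_univ q)

theorem prob_compl (q : ℝ) (E : Set (World n)) : prob q Eᶜ = 1 - prob q E := by
  rw [← prob_univ (n := n) q, prob, prob, prob, ← Finset.sum_sub_distrib]
  refine Finset.sum_congr rfl fun ω _ => ?_
  by_cases h : ω ∈ E <;> simp [h]

/-! ### Optimality of the Bayesian guess -/

open Classical in
theorem prob_eq_sum_fiber (q : ℝ) {I : Type} (X : (Fin n → Bool) → I) (E : Set (World n)) :
    prob q E = ∑ i ∈ Finset.univ.image X, prob q {ω | ω ∈ E ∧ X ω.2 = i} := by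
  simp only [prob]
  rw [Finset.sum_comm]
  refine Finset.sum_congr rfl fun ω _ => ?_
  rw [Finset.sum_eq_single (X ω.2)]
  · by_cases h : ω ∈ E <;> simp [Set.indicator, h]
  · intro i _ hi
    simp [Set.indicator, hi.symm]
  · intro h
    exact absurd (Finset.mem_image_of_mem X (Finset.mem_univ _)) h

theorem posterior_le_posterior_bayesGuess (q : ℝ) {I : Type} (X : (Fin n → Bool) → I) (i : I)
    (t b : Bool) : posterior q X i b ≤ posterior q X i (bayesGuess q X i t) := by
  unfold bayesGuess
  split_ifs with h₁ h₂ <;> cases b <;> cases t <;> grind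

theorem prob_eq_posterior_mul {q : ℝ} (hq0 : 0 ≤ q) (hq1 : q ≤ 1) {I : Type}
    (X : (Fin n → Bool) → I) (i : I) (b : Bool) :
    prob q {ω : World n | ω.1 = b ∧ X ω.2 = i} =
      posterior q X i b * prob q {ω : World n | X ω.2 = i} := by
  unfold posterior
  -- In the null case the posterior is `0` by division by zero, but the joint probability vanishes
  -- too.
  rcases eq_or_ne (prob q {ω : World n | X ω.2 = i}) 0 with h | h
  · rw [h, mul_zero]
    refine le_antisymm ?_ (prob_nonneg hq0 hq1 _)
    rw [← h]
    exact prob_mono hq0 hq1 fun ω hω => hω.2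
  · rw [div_mul_cancel₀ _ h]

/-- The Bayesian guess is at least as good as any other guess on the same information. -/
theorem prob_le_prob_bayesGuess {q : ℝ} (hq0 : 0 ≤ q) (hq1 : q ≤ 1) {I : Type}
    (X : (Fin n → Bool) → I) (t f : I → Bool) :
    prob q {ω : World n | f (X ω.2) = ω.1} ≤
      prob q {ω : World n | bayesGuess q X (X ω.2) (t (X ω.2)) = ω.1} := by
  classical
  rw [prob_eq_sum_fiber q X, prob_eq_sum_fiber q X {ω | bayesGuess _ _ _ _ = _}]
  refine Finset.sum_le_sum fun i _ => ?_
  have key : ∀ g : I → Bool, {ω : World n | ω ∈ {ω : World n | g (X ω.2) = ω.1} ∧ X ω.2 = i} =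
      {ω | ω.1 = g i ∧ X ω.2 = i} := by
    intro g
    ext ω
    simp only [Set.mem_ofPred_eq]
    constructor <;> rintro ⟨h₁, h₂⟩ <;> subst h₂ <;> exact ⟨h₁.symm, rfl⟩
  rw [key f, key fun i => bayesGuess q X i (t i), prob_eq_posterior_mul hq0 hq1,
    prob_eq_posterior_mul hq0 hq1]
  exact mul_le_mul_of_nonneg_right (posterior_le_posterior_bayesGuess _ _ _ _ _)
    (prob_nonneg hq0 hq1 _)

/-- An agent does at least as well as by any guess on the information that it sees. -/
theorem prob_le_agentQuality {q : ℝ} (hq0 : 0 ≤ q) (hq1 : q ≤ 1) (τ : TieBreak n)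
    (G : SimpleGraph (Fin n)) (σ : Equiv.Perm (Fin n)) (v : Fin n) (f : Info G σ v → Bool) :
    prob q {ω : World n | f (ω.2 v, fun u => action q τ G σ u.1 ω.2) = ω.1} ≤
      agentQuality q τ G σ v := by
  unfold agentQuality
  have h := prob_le_prob_bayesGuess hq0 hq1
    (fun s : Fin n → Bool => ((s v, fun u => action q τ G σ u.1 s) : Info G σ v)) (τ G σ v) f
  convert h using 4
  rw [action]

/-- Copying the action of `u` is one of the guesses available to `v`. -/
theorem agentQuality_le_of_adj {q : ℝ} (hq0 : 0 ≤ q) (hq1 : q ≤ 1) (τ : TieBreak n)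
    (G : SimpleGraph (Fin n)) (σ : Equiv.Perm (Fin n)) {u v : Fin n} (h : G.Adj v u)
    (hσ : σ u < σ v) : agentQuality q τ G σ u ≤ agentQuality q τ G σ v :=
  prob_le_agentQuality hq0 hq1 τ G σ v fun i => i.2 ⟨u, h, hσ⟩

/-! ### Agents acting on their own signals, and majorities -/

theorem prob_truth_and_signal (q : ℝ) (v : Fin n) (b c : Bool) :
    prob q {ω : World n | ω.1 = b ∧ ω.2 v = c} = 1 / 2 * if c = b then q else 1 - q := by
  have h := sum_worldWeight_mul_prod (n := n) q
    fun b' v' s => if v' = v then if b' = b ∧ s = c then 1 else 0 else 1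
  have hf : ∀ b', ∏ v', (q * (if v' = v then if b' = b ∧ b' = c then (1 : ℝ) else 0 else 1) +
      (1 - q) * if v' = v then if b' = b ∧ (!b') = c then (1 : ℝ) else 0 else 1) =
      q * (if b' = b ∧ b' = c then (1 : ℝ) else 0) +
        (1 - q) * if b' = b ∧ (!b') = c then (1 : ℝ) else 0 := by
    intro b'
    rw [Finset.prod_eq_single v]
    · simp
    · intro v' _ hv'
      simp [hv']
    · simp
  simp_rw [hf] at h
  rw [prob]
  calc _ = _ := Finset.sum_congr rfl fun ω _ => ?_
    _ = _ := h
    _ = _ := by cases b <;> cases c <;> simp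
  rw [Finset.prod_eq_single v (fun v' _ hv' => by simp [hv']) (by simp)]
  simp [Set.indicator]

/-- Without earlier neighbours the information is the signal alone, and the posteriors are in ratio
`q : 1 - q`. As `q > 1/2` there is no tie. -/
theorem action_eq_signal {q : ℝ} (hq : 1 / 2 < q) (hq1 : q < 1) (τ : TieBreak n)
    (G : SimpleGraph (Fin n)) (σ : Equiv.Perm (Fin n)) (v : Fin n)
    (h : ∀ u, G.Adj v u → ¬ σ u < σ v) (s : Fin n → Bool) : action q τ G σ v s = s v := by
  have : IsEmpty (EarlierNbr G σ v) := ⟨fun u => h u.1 u.2.1 u.2.2⟩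
  rw [action]
  set X : (Fin n → Bool) → Info G σ v :=
    fun s' => (s' v, fun u : EarlierNbr G σ v => action q τ G σ u.1 s')
  have hX : ∀ s', X s' = X s ↔ s' v = s v := fun s' => by
    simp [X, Prod.ext_iff, eq_iff_true_of_subsingleton]
  have hnum : ∀ b, prob q {ω : World n | ω.1 = b ∧ X ω.2 = X s} =
      1 / 2 * if s v = b then q else 1 - q := fun b => by
    simp_rw [hX]
    exact prob_truth_and_signal q v b (s v)
  have hpos : 0 < prob q {ω : World n | X ω.2 = X s} := by
    refine lt_of_lt_of_le ?_ (prob_mono (by linarith) hq1.le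
      (fun ω hω => hω.2 : {ω : World n | ω.1 = s v ∧ X ω.2 = X s} ⊆ _))
    rw [hnum, if_pos rfl]
    linarith
  have hpost : ∀ b, posterior q X (X s) b =
      (1 / 2 * if s v = b then q else 1 - q) / prob q {ω : World n | X ω.2 = X s} := fun b => by
    rw [posterior, hnum]
  change bayesGuess q X (X s) _ = s v
  unfold bayesGuess
  simp only [hpost, div_lt_div_iff_of_pos_right hpos]
  cases s v
  · rw [if_neg, if_pos] <;> norm_num <;> linarith
  · rw [if_pos]; norm_num; linarith

/-- The probability that the majority of the signals of `W` is not correct is exponentially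
small in the size of `W`. -/
theorem prob_majority_wrong_le {q : ℝ} (hq : 1 / 2 < q) (hq1 : q < 1) (W : Finset (Fin n)) :
    prob q {ω : World n | (W.filter fun v => ω.2 v = ω.1).card ≤
      (W.filter fun v => ¬ ω.2 v = ω.1).card} ≤ (1 / 2 + 2 * q * (1 - q)) ^ W.card := by
  -- Chernoff bound: a correct signal has weight `1/(2q)`, a wrong one `2q > 1`. The product is at
  -- least `1` when the majority fails, and each factor has mean `1/2 + 2q(1-q) < 1`.
  have h := sum_worldWeight_mul_prod (n := n) q
    fun b v s => if v ∈ W then if s = b then (2 * q)⁻¹ else 2 * q else 1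
  have hf : ∀ b : Bool, ∏ v, (q * (if v ∈ W then if b = b then (2 * q)⁻¹ else 2 * q else 1) +
      (1 - q) * if v ∈ W then if (!b) = b then (2 * q)⁻¹ else 2 * q else 1) =
      (1 / 2 + 2 * q * (1 - q)) ^ W.card := by
    intro b
    rw [← Finset.prod_const, ← Finset.prod_subset (Finset.subset_univ W)]
    · refine Finset.prod_congr rfl fun v hv => ?_
      have : q ≠ 0 := by linarith
      simp only [hv, if_true, Bool.not_eq_self, if_false]
      field_simp
    · intro v _ hv
      simp [hv]
  rw [Finset.sum_congr rfl fun b _ => hf b] at h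
  calc _ ≤ _ := Finset.sum_le_sum fun ω _ => ?_
    _ = _ := h
    _ = _ := by simp
  have hw := worldWeight_nonneg (n := n) (q := q) (by linarith) hq1.le ω
  have hprod : ∏ v, (if v ∈ W then if ω.2 v = ω.1 then (2 * q)⁻¹ else 2 * q else 1) =
      ((2 * q) ^ (W.filter fun v => ω.2 v = ω.1).card)⁻¹ *
        (2 * q) ^ (W.filter fun v => ¬ ω.2 v = ω.1).card := by
    rw [Finset.prod_ite_mem, Finset.univ_inter, Finset.prod_ite, Finset.prod_const,
      Finset.prod_const, inv_pow]
  rw [hprod]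
  by_cases hω : (W.filter fun v => ω.2 v = ω.1).card ≤ (W.filter fun v => ¬ ω.2 v = ω.1).card
  · rw [Set.indicator_of_mem (by exact hω)]
    refine le_mul_of_one_le_right hw ?_
    rw [inv_mul_eq_div, one_le_div (by positivity)]
    exact pow_le_pow_right₀ (by linarith) hω
  · rw [Set.indicator_of_notMem (by exact hω)]
    positivity

/-! ### Decision orders that spread a good guess -/

theorem exists_perm_lt_of_lt (r : Fin n → ℕ) :
    ∃ σ : Equiv.Perm (Fin n), ∀ u v, r u < r v → σ u < σ v := by
  refine ⟨(Tuple.sort r).symm, fun u v h => ?_⟩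
  by_contra! hle
  have := Tuple.monotone_sort r hle
  simp only [Function.comp_apply, Equiv.apply_symm_apply] at this
  omega

/-- An agent with independent earlier neighbours that act on their own signals does at least as
well as by following their majority. -/
theorem le_agentQuality_of_signals {q : ℝ} (hq : 1 / 2 < q) (hq1 : q < 1) (τ : TieBreak n)
    (G : SimpleGraph (Fin n)) (σ : Equiv.Perm (Fin n)) (v : Fin n) (W : Finset (Fin n))
    (hadj : ∀ w ∈ W, G.Adj v w ∧ σ w < σ v)
    (hW : ∀ w ∈ W, ∀ u, G.Adj w u → ¬ σ u < σ w) :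
    1 - (1 / 2 + 2 * q * (1 - q)) ^ W.card ≤ agentQuality q τ G σ v := by
  classical
  have hq0 : 0 ≤ q := by linarith
  -- The guess is the majority within `W`, ignoring other earlier neighbours. A tied vote counts as
  -- wrong in `prob_majority_wrong_le`, so its value is immaterial.
  refine le_trans ?_ (prob_le_agentQuality hq0 hq1.le τ G σ v fun i =>
    decide ((W.filter fun w => ∃ h, i.2 ⟨w, h⟩ = false).card <
      (W.filter fun w => ∃ h, i.2 ⟨w, h⟩ = true).card))
  have hfilter : ∀ (b : Bool) (s : Fin n → Bool),
      (W.filter fun w => ∃ h : G.Adj v w ∧ σ w < σ v, action q τ G σ w s = b) =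
        W.filter fun w => s w = b := by
    intro b s
    refine Finset.filter_congr fun w hw => ?_
    rw [action_eq_signal hq hq1 τ G σ w (hW w hw)]
    exact ⟨fun ⟨_, h⟩ => h, fun h => ⟨hadj w hw, h⟩⟩
  refine (sub_le_sub_left (prob_majority_wrong_le hq hq1 W) 1).trans ?_
  rw [← prob_compl]
  refine prob_mono hq0 hq1.le fun ω hω => ?_
  simp only [Set.mem_compl_iff, Set.mem_ofPred_eq, not_le] at hω ⊢
  simp only [hfilter]
  cases hθ : ω.1
  · simp only [hθ, Bool.not_eq_false] at hω
    simpa using hω.le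
  · simp only [hθ, Bool.not_eq_true] at hω
    simpa using hω

/-- If the agents of an independent set `W` of neighbours of `v` decide first, then everyone who is
connected to `v` outside of `W` can learn as much as `v` does. -/
theorem exists_order_le_agentQuality {q : ℝ} (hq : 1 / 2 < q) (hq1 : q < 1) (τ : TieBreak n)
    (G H : SimpleGraph (Fin n)) (hH : H ≤ G) (W : Finset (Fin n)) (v : Fin n) (hv : v ∉ W)
    (hadj : ∀ w ∈ W, G.Adj v w) (hind : ∀ w ∈ W, ∀ w' ∈ W, ¬ G.Adj w w')
    (hHW : ∀ a b, H.Adj a b → a ∉ W) :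
    ∃ σ : Equiv.Perm (Fin n), ∀ u, H.Reachable v u →
      1 - (1 / 2 + 2 * q * (1 - q)) ^ W.card ≤ agentQuality q τ G σ u := by
  classical
  -- Vertices unreachable from `v` have `dist` `0` and share rank `1` with `v`. This is harmless:
  -- only `W` before everyone else and increasing distance along `H`-paths from `v` matter.
  obtain ⟨σ, hσ⟩ := exists_perm_lt_of_lt fun u => if u ∈ W then 0 else H.dist v u + 1
  refine ⟨σ, fun u => ?_⟩
  induction hd : H.dist v u using Nat.strong_induction_on generalizing u with
  | _ d ih =>
    intro hu
    obtain ⟨p, hp⟩ := hu.symm.exists_walk_length_eq_dist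
    rw [SimpleGraph.dist_comm, hd] at hp
    cases p with
    | nil =>
      refine le_agentQuality_of_signals hq hq1 τ G σ _ W (fun w hw => ⟨hadj w hw, hσ _ _ ?_⟩)
        fun w hw u' hwu' hlt => ?_
      · simp [hw, hv]
      · have hu' : u' ∉ W := fun h => hind w hw u' h hwu'
        refine lt_asymm hlt (hσ _ _ ?_)
        simp [hw, hu']
    | @cons _ u' _ h p =>
      rw [SimpleGraph.Walk.length_cons] at hp
      -- The next vertex on a shortest path to `v` is strictly closer, so it decides earlier and can
      -- be copied.
      have hlt : H.dist v u' < d := by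
        have := SimpleGraph.dist_le p
        rw [SimpleGraph.dist_comm] at this
        omega
      refine (ih _ hlt u' rfl p.reachable.symm).trans
        (agentQuality_le_of_adj (by linarith) hq1.le τ G σ (hH h) (hσ _ _ ?_))
      simpa [hHW _ _ h, hHW _ _ h.symm, hd] using hlt

/-! ### Elementary bounds on the qualities -/

theorem agentQuality_nonneg {q : ℝ} (hq0 : 0 ≤ q) (hq1 : q ≤ 1) (τ : TieBreak n)
    (G : SimpleGraph (Fin n)) (σ : Equiv.Perm (Fin n)) (v : Fin n) :
    0 ≤ agentQuality q τ G σ v := prob_nonneg hq0 hq1 _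

theorem networkQuality_le_one {q : ℝ} (hq0 : 0 ≤ q) (hq1 : q ≤ 1) (τ : TieBreak n)
    (G : SimpleGraph (Fin n)) (σ : Equiv.Perm (Fin n)) : networkQuality q τ G σ ≤ 1 := by
  unfold networkQuality
  have h : ∑ v, agentQuality q τ G σ v ≤ ∑ _v : Fin n, (1 : ℝ) :=
    Finset.sum_le_sum fun v _ => prob_le_one hq0 hq1 _
  rw [Finset.sum_const, Finset.card_univ, Fintype.card_fin, nsmul_one] at h
  rw [one_div_mul_eq_div]
  exact div_le_one_of_le₀ h (Nat.cast_nonneg n)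

theorem optimalQuality_le_one {q : ℝ} (hq0 : 0 ≤ q) (hq1 : q ≤ 1) (τ : TieBreak n)
    (G : SimpleGraph (Fin n)) : optimalQuality q τ G ≤ 1 :=
  ciSup_le fun σ => networkQuality_le_one hq0 hq1 τ G σ

theorem networkQuality_le_optimalQuality (q : ℝ) (τ : TieBreak n) (G : SimpleGraph (Fin n))
    (σ : Equiv.Perm (Fin n)) : networkQuality q τ G σ ≤ optimalQuality q τ G :=
  le_ciSup (Set.finite_range _).bddAbove σ

theorem optimalQuality_nonneg {q : ℝ} (hq0 : 0 ≤ q) (hq1 : q ≤ 1) (τ : TieBreak n)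
    (G : SimpleGraph (Fin n)) : 0 ≤ optimalQuality q τ G := by
  refine le_trans ?_ (networkQuality_le_optimalQuality q τ G 1)
  exact mul_nonneg (by positivity) (Finset.sum_nonneg fun v _ => agentQuality_nonneg hq0 hq1 _ _ _ _)

/-! ### Large components and the deterministic criterion -/

/-- In a graph in which any two disjoint subsets of `R` of size `k` are joined by an edge, most
vertices of `R` are connected to most of `R`. -/
theorem exists_subset_reachable {V : Type*} [DecidableEq V] (H : SimpleGraph V) (R : Finset V)
    (k : ℕ) (hk : k ≤ R.card)
    (hexp : ∀ S ⊆ R, ∀ T ⊆ R, Disjoint S T → k ≤ S.card → k ≤ T.card →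
      ∃ s ∈ S, ∃ t ∈ T, H.Adj s t) :
    ∃ S ⊆ R, R.card < S.card + k + 1 ∧
      ∀ v ∈ S, ∃ C : Finset V, R.card < C.card + 2 * k + 1 ∧ ∀ u ∈ C, H.Reachable v u := by
  classical
  -- `S` is a smallest subset of `R` with at least `k` vertices and no edge to the rest of `R`.
  -- Expansion bounds `R \ S`; minimality bounds what remains of `S` after removing the vertices
  -- reachable from `v`, as this remainder is again closed.
  obtain ⟨S, hS, hmin⟩ := Finset.exists_min_image
    (R.powerset.filter fun S => k ≤ S.card ∧ ∀ a ∈ S, ∀ b ∈ R, H.Adj a b → b ∈ S) Finset.card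
    ⟨R, by simpa [hk] using fun _ _ b hb _ => hb⟩
  simp only [Finset.mem_filter, Finset.mem_powerset] at hS hmin
  obtain ⟨hSR, hkS, hclosed⟩ := hS
  have hcompl : (R \ S).card ≤ k := by
    by_contra! h
    obtain ⟨s, hs, t, ht, hst⟩ := hexp S hSR (R \ S) Finset.sdiff_subset Finset.disjoint_sdiff hkS
      h.le
    rw [Finset.mem_sdiff] at ht
    exact ht.2 (hclosed s hs t ht.1 hst)
  have hcard := Finset.card_sdiff_add_card_eq_card hSR
  refine ⟨S, hSR, by omega, fun v hv => ⟨S.filter (H.Reachable v), ?_, by simp⟩⟩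
  have hrest : (S.filter fun u => ¬ H.Reachable v u).card < k := by
    by_contra! h
    have hle := hmin (S.filter fun u => ¬ H.Reachable v u)
      ⟨(Finset.filter_subset _ _).trans hSR, h, fun a ha b hb hab => ?_⟩
    · have hlt : (S.filter fun u => ¬ H.Reachable v u).card < S.card :=
        Finset.card_lt_card (Finset.filter_ssubset.2 ⟨v, hv, by simp⟩)
      omega
    · rw [Finset.mem_filter] at ha ⊢
      exact ⟨hclosed a ha.1 b hb hab, fun hb' => ha.2 (hb'.trans hab.symm.reachable)⟩
  have := Finset.card_filter_add_card_filter_not (s := S) (H.Reachable v)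
  omega

theorem le_optimalQuality_of_expanding {q : ℝ} (hq : 1 / 2 < q) (hq1 : q < 1) (τ : TieBreak n)
    (G : SimpleGraph (Fin n)) (U D : Finset (Fin n)) (k K : ℕ)
    (hexp : ∀ S T : Finset (Fin n), Disjoint S T → k ≤ S.card → k ≤ T.card →
      ∃ s ∈ S, ∃ t ∈ T, G.Adj s t)
    (hD : ∀ v, v ∉ U → v ∉ D → ∃ W ⊆ U, W.card = K ∧ (∀ w ∈ W, G.Adj v w) ∧
      ∀ w ∈ W, ∀ w' ∈ W, ¬ G.Adj w w')
    (hcard : U.card + D.card + k < n) :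
    ((n - U.card - 2 * k : ℝ) / n) * (1 - (1 / 2 + 2 * q * (1 - q)) ^ K) ≤
      optimalQuality q τ G := by
  classical
  -- `G` with all vertices of `U` isolated, so that paths in `H` avoid every possible `W ⊆ U`.
  let H : SimpleGraph (Fin n) :=
    { Adj := fun a b => G.Adj a b ∧ a ∉ U ∧ b ∉ U
      symm := ⟨fun a b h => ⟨h.1.symm, h.2.2, h.2.1⟩⟩
      loopless := ⟨fun a h => G.irrefl h.1⟩ }
  have hUc : Uᶜ.card = n - U.card := by rw [Finset.card_compl, Fintype.card_fin]
  obtain ⟨S, hSU, hS, hC⟩ := exists_subset_reachable H Uᶜ k (by omega)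
    fun S hS T hT hST hkS hkT => by
      obtain ⟨s, hs, t, ht, hst⟩ := hexp S T hST hkS hkT
      exact ⟨s, hs, t, ht, hst, Finset.mem_compl.1 (hS hs), Finset.mem_compl.1 (hT ht)⟩
  -- `S` misses at most `k` vertices of `Uᶜ`, so by `hcard` it is too large to lie in `D`. One good
  -- vertex is enough.
  obtain ⟨v, hvS, hvD⟩ : ∃ v ∈ S, v ∉ D := by
    by_contra! h
    have := Finset.card_le_card h
    omega
  have hvU : v ∉ U := Finset.mem_compl.1 (hSU hvS)
  obtain ⟨W, hWU, rfl, hadj, hind⟩ := hD v hvU hvD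
  obtain ⟨C, hCcard, hC⟩ := hC v hvS
  obtain ⟨σ, hσ⟩ := exists_order_le_agentQuality hq hq1 τ G H (fun a b h => h.1) W v
    (fun h => hvU (hWU h)) hadj hind fun a b h ha => h.2.1 (hWU ha)
  refine le_trans ?_ (networkQuality_le_optimalQuality q τ G σ)
  have hρ : 0 ≤ 1 - (1 / 2 + 2 * q * (1 - q)) ^ W.card :=
    sub_nonneg.2 (pow_le_one₀ (by nlinarith) (by nlinarith))
  have hCn : (n - U.card - 2 * k : ℝ) ≤ C.card := by
    have : n ≤ C.card + U.card + 2 * k := by omega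
    have : (n : ℝ) ≤ C.card + U.card + 2 * k := by exact_mod_cast this
    linarith
  unfold networkQuality
  rw [one_div_mul_eq_div, div_mul_eq_mul_div]
  refine div_le_div_of_nonneg_right ?_ (Nat.cast_nonneg n)
  calc _ ≤ (C.card : ℝ) * (1 - (1 / 2 + 2 * q * (1 - q)) ^ W.card) := by gcongr
    _ = ∑ _u ∈ C, (1 - (1 / 2 + 2 * q * (1 - q)) ^ W.card) := by
      rw [Finset.sum_const, nsmul_eq_mul]
    _ ≤ ∑ u ∈ C, agentQuality q τ G σ u := Finset.sum_le_sum fun u hu => hσ u (hC u hu)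
    _ ≤ ∑ u, agentQuality q τ G σ u :=
      Finset.sum_le_sum_of_subset_of_nonneg (Finset.subset_univ C)
        fun u _ _ => agentQuality_nonneg (by linarith) hq1.le _ _ _ _

/-! ### Edge probabilities in the binomial random graph -/

open MeasureTheory SimpleGraph unitInterval

instance {V : Type*} [Finite V] : MeasurableSingletonClass (SimpleGraph V) :=
  ⟨fun G => by
    have h : ({G} : Set (SimpleGraph V)) = ⋂ u, ⋂ v, {G' | G'.Adj u v ↔ G.Adj u v} := by
      ext G'
      simp [SimpleGraph.ext_iff, funext_iff]
    rw [h]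
    refine .iInter fun u => .iInter fun v => measurableSet_setOfPred.2 ?_
    exact (measurable_iff_adj.1 measurable_id u v).iff measurable_const⟩

/-- The presence or absence of different edges in the binomial random graph is independent. -/
theorem binomialRandom_forall_edge (p : I) {V : Type*} [Finite V] (T : Finset (Sym2 V))
    (hT : ∀ e ∈ T, ¬ e.IsDiag) (A : Set Prop) :
    binomialRandom V p {G | ∀ e ∈ T, (e ∈ G.edgeSet) ∈ A} =
      ((toNNReal p • Measure.dirac True + toNNReal (σ p) • Measure.dirac False : Measure Prop) A)
        ^ T.card := by
  classical
  have := Fintype.ofFinite V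
  rw [binomialRandom_eq_map, Measure.map_apply measurable_fromEdgeSet .of_discrete,
    ProbabilityTheory.setBernoulli_apply']
  have hset : (fun p : Sym2 V → Prop => {i | p i}) ⁻¹' (fromEdgeSet ⁻¹'
      {G : SimpleGraph V | ∀ e ∈ T, (e ∈ G.edgeSet) ∈ A}) = (T : Set (Sym2 V)).pi fun _ => A := by
    ext f
    simp only [Set.mem_preimage, Set.mem_ofPred_eq, Set.mem_pi, Finset.mem_coe, edgeSet_fromEdgeSet]
    refine forall₂_congr fun e he => ?_
    have : (e ∈ {i | f i} \ Sym2.diagSet) = f e := by simp [hT e he]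
    rw [this]
  rw [hset, Measure.infinitePi_pi _ fun _ _ => .of_discrete, ← Finset.prod_const]
  refine Finset.prod_congr rfl fun e he => ?_
  simp [hT e he]

theorem binomialRandom_real_forall_mem (p : I) {V : Type*} [Finite V] (T : Finset (Sym2 V))
    (hT : ∀ e ∈ T, ¬ e.IsDiag) :
    (binomialRandom V p).real {G | ∀ e ∈ T, e ∈ G.edgeSet} = (p : ℝ) ^ T.card := by
  have h := binomialRandom_forall_edge p T hT {P | P}
  simp only [Set.mem_ofPred_eq] at h
  rw [measureReal_def, h]
  simp

theorem binomialRandom_real_forall_notMem (p : I) {V : Type*} [Finite V] (T : Finset (Sym2 V))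
    (hT : ∀ e ∈ T, ¬ e.IsDiag) :
    (binomialRandom V p).real {G | ∀ e ∈ T, e ∉ G.edgeSet} = (1 - p : ℝ) ^ T.card := by
  have h := binomialRandom_forall_edge p T hT {P | ¬ P}
  simp only [Set.mem_ofPred_eq] at h
  rw [measureReal_def, h]
  simp

theorem binomialRandom_real_no_edge_between (p : I) {V : Type*} [Finite V] (S T : Finset V)
    (hST : Disjoint S T) :
    (binomialRandom V p).real {G | ∀ s ∈ S, ∀ t ∈ T, ¬ G.Adj s t} =
      (1 - p : ℝ) ^ (S.card * T.card) := by
  classical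
  -- Disjointness makes the edges between `S` and `T` distinct, so the exponent is the full product.
  have hinj : Set.InjOn (fun x : V × V => s(x.1, x.2)) (S ×ˢ T : Finset (V × V)) := by
    rintro ⟨a, b⟩ h₁ ⟨c, d⟩ h₂ h
    simp only [Finset.coe_product, Set.mem_prod, Finset.mem_coe, Sym2.eq_iff] at h₁ h₂ h
    rcases h with h | h
    · exact Prod.ext h.1 h.2
    · exact absurd (h.1 ▸ h₁.1) (Finset.disjoint_right.1 hST h₂.2)
  have h := binomialRandom_real_forall_notMem p
    ((S ×ˢ T).image fun x : V × V => s(x.1, x.2)) (by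
      simp only [Finset.mem_image, Finset.mem_product, Prod.exists]
      rintro e ⟨a, b, ⟨ha, hb⟩, rfl⟩ hd
      rw [Sym2.mk_isDiag_iff] at hd
      exact Finset.disjoint_left.1 hST ha (hd ▸ hb))
  rw [Finset.card_image_of_injOn hinj, Finset.card_product] at h
  rw [← h]
  congr 1
  ext G
  simp only [Set.mem_ofPred_eq, Finset.mem_image, Finset.mem_product, Prod.exists]
  constructor
  · rintro h e ⟨a, b, ⟨ha, hb⟩, rfl⟩
    exact h a ha b hb
  · exact fun h a ha b hb => h _ ⟨a, b, ⟨ha, hb⟩, rfl⟩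

theorem binomialRandom_real_triangle (p : I) {V : Type*} [Finite V] {a b c : V} (hab : a ≠ b)
    (hac : a ≠ c) (hbc : b ≠ c) :
    (binomialRandom V p).real {G | G.Adj a b ∧ G.Adj a c ∧ G.Adj b c} = (p : ℝ) ^ 3 := by
  classical
  have h := binomialRandom_real_forall_mem p {s(a, b), s(a, c), s(b, c)} (by
    simp [hab, hac, hbc])
  rw [Finset.card_eq_three.2 ⟨s(a, b), s(a, c), s(b, c), by simp [hbc, hac], by
    simp [hab, hac], by simp [hac, hab], rfl⟩] at h
  rw [← h]
  congr 1
  ext G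
  simp

/-! ### Expansion and bad vertices -/

/-- Any two disjoint sets of at least `k` vertices are joined by an edge. -/
def Expanding {V : Type*} (G : SimpleGraph V) (k : ℕ) : Prop :=
  ∀ S T : Finset V, Disjoint S T → k ≤ S.card → k ≤ T.card → ∃ s ∈ S, ∃ t ∈ T, G.Adj s t

/-- Union bound over at most `2^n * 2^n` pairs of sets, each pair with at least `k^2` missing edges.
-/
theorem binomialRandom_real_not_expanding_le (p : I) (k : ℕ) :
    (binomialRandom (Fin n) p).real {G | ¬ Expanding G k} ≤ 4 ^ n * (1 - p : ℝ) ^ k ^ 2 := by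
  classical
  have hsub : {G : SimpleGraph (Fin n) | ¬ Expanding G k} ⊆
      ⋃ x ∈ (Finset.univ : Finset (Finset (Fin n) × Finset (Fin n))).filter fun x =>
        Disjoint x.1 x.2 ∧ k ≤ x.1.card ∧ k ≤ x.2.card,
        {G | ∀ s ∈ x.1, ∀ t ∈ x.2, ¬ G.Adj s t} := by
    intro G hG
    simp only [Set.mem_ofPred_eq, Expanding] at hG
    push Not at hG
    obtain ⟨S, T, hST, hS, hT, h⟩ := hG
    simp only [Set.mem_iUnion]
    exact ⟨(S, T), by simp [hST, hS, hT], h⟩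
  have hp0 : (0 : ℝ) ≤ 1 - p := sub_nonneg.2 p.2.2
  have hp1 : (1 - p : ℝ) ≤ 1 := sub_le_self _ p.2.1
  calc _ ≤ _ := (measureReal_mono hsub (measure_ne_top _ _)).trans
          (measureReal_biUnion_finset_le _ _)
    _ ≤ ∑ x ∈ (Finset.univ : Finset (Finset (Fin n) × Finset (Fin n))).filter fun x =>
        Disjoint x.1 x.2 ∧ k ≤ x.1.card ∧ k ≤ x.2.card, (1 - p : ℝ) ^ k ^ 2 := by
      refine Finset.sum_le_sum fun x hx => ?_
      obtain ⟨-, hd, h₁, h₂⟩ := Finset.mem_filter.1 hx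
      rw [binomialRandom_real_no_edge_between p _ _ hd]
      refine pow_le_pow_of_le_one hp0 hp1 ?_
      rw [sq]
      exact Nat.mul_le_mul h₁ h₂
    _ ≤ ∑ x : Finset (Fin n) × Finset (Fin n), (1 - p : ℝ) ^ k ^ 2 :=
      Finset.sum_le_sum_of_subset_of_nonneg (Finset.filter_subset _ _)
        fun _ _ _ => pow_nonneg hp0 _
    _ = _ := by
      rw [Finset.sum_const, Finset.card_univ, Fintype.card_prod, Fintype.card_finset,
        Fintype.card_fin, nsmul_eq_mul, ← mul_pow]
      norm_num

/-- The vertex `v` has no neighbour in one of the blocks `B i`, or two adjacent neighbours in their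
union. -/
def IsBad {V : Type*} {K : ℕ} (B : Fin K → Finset V) (G : SimpleGraph V) (v : V) : Prop :=
  (∃ i, ∀ u ∈ B i, ¬ G.Adj v u) ∨
    ∃ i j, ∃ u ∈ B i, ∃ w ∈ B j, G.Adj v u ∧ G.Adj v w ∧ G.Adj u w

/-- Pick one neighbour from each block: disjointness of the blocks makes them distinct, and the
absence of triangles makes them independent. -/
theorem exists_independent_of_not_isBad {V : Type*} [DecidableEq V] {K : ℕ} {B : Fin K → Finset V}
    (hB : Pairwise fun i j => Disjoint (B i) (B j)) {G : SimpleGraph V} {v : V}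
    (h : ¬ IsBad B G v) :
    ∃ W ⊆ Finset.univ.biUnion B, W.card = K ∧ (∀ w ∈ W, G.Adj v w) ∧
      ∀ w ∈ W, ∀ w' ∈ W, ¬ G.Adj w w' := by
  unfold IsBad at h
  push Not at h
  obtain ⟨h₁, h₂⟩ := h
  choose f hf hadj using h₁
  have hinj : Function.Injective f := fun i j hij => by
    by_contra hne
    exact Finset.disjoint_left.1 (hB hne) (hf i) (hij ▸ hf j)
  refine ⟨Finset.univ.image f, ?_, ?_, ?_, ?_⟩
  · intro w hw
    obtain ⟨i, -, rfl⟩ := Finset.mem_image.1 hw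
    exact Finset.mem_biUnion.2 ⟨i, Finset.mem_univ i, hf i⟩
  · rw [Finset.card_image_of_injective _ hinj, Finset.card_univ, Fintype.card_fin]
  · simpa using hadj
  · simpa using fun i j => h₂ i j _ (hf i) _ (hf j) (hadj i) (hadj j)

/-- Union bound over the `K` blocks and the `(K l)^2` ordered pairs of block vertices. -/
theorem binomialRandom_real_isBad_le (p : I) {V : Type*} [Finite V] {K l : ℕ}
    (B : Fin K → Finset V) (hB : ∀ i, (B i).card = l) (v : V) (hv : ∀ i, v ∉ B i) :
    (binomialRandom V p).real {G | IsBad B G v} ≤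
      K * (1 - p : ℝ) ^ l + (K * l) ^ 2 * (p : ℝ) ^ 3 := by
  classical
  have hsub : {G : SimpleGraph V | IsBad B G v} ⊆
      (⋃ i ∈ (Finset.univ : Finset (Fin K)), {G | ∀ s ∈ ({v} : Finset V), ∀ t ∈ B i, ¬ G.Adj s t}) ∪
      ⋃ i ∈ (Finset.univ : Finset (Fin K)), ⋃ j ∈ (Finset.univ : Finset (Fin K)),
        ⋃ u ∈ B i, ⋃ w ∈ B j, {G | G.Adj v u ∧ G.Adj v w ∧ G.Adj u w} := by
    rintro G (⟨i, h⟩ | ⟨i, j, u, hu, w, hw, h⟩)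
    · left
      simp only [Set.mem_iUnion]
      exact ⟨i, Finset.mem_univ i, by simpa using h⟩
    · right
      simp only [Set.mem_iUnion]
      exact ⟨i, Finset.mem_univ i, j, Finset.mem_univ j, u, hu, w, hw, h⟩
  refine (measureReal_mono hsub).trans ((measureReal_union_le _ _).trans (add_le_add ?_ ?_))
  · refine (measureReal_biUnion_finset_le _ _).trans_eq ?_
    rw [Finset.sum_congr rfl fun i _ => binomialRandom_real_no_edge_between p {v} (B i)
      (Finset.disjoint_singleton_left.2 (hv i))]
    simp [hB]
  · have htri : ∀ i, ∀ u ∈ B i, ∀ j, ∀ w ∈ B j,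
        (binomialRandom V p).real {G | G.Adj v u ∧ G.Adj v w ∧ G.Adj u w} ≤ (p : ℝ) ^ 3 := by
      intro i u hu j w hw
      rcases eq_or_ne u w with rfl | hne
      · simpa using pow_nonneg p.2.1 3
      · exact (binomialRandom_real_triangle p (by rintro rfl; exact hv i hu)
          (by rintro rfl; exact hv j hw) hne).le
    calc _ ≤ ∑ i : Fin K, ∑ j : Fin K, ∑ u ∈ B i, ∑ w ∈ B j, (p : ℝ) ^ 3 := by
          refine (measureReal_biUnion_finset_le _ _).trans (Finset.sum_le_sum fun i _ => ?_)
          refine (measureReal_biUnion_finset_le _ _).trans (Finset.sum_le_sum fun j _ => ?_)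
          refine (measureReal_biUnion_finset_le _ _).trans (Finset.sum_le_sum fun u hu => ?_)
          exact (measureReal_biUnion_finset_le _ _).trans
            (Finset.sum_le_sum fun w hw => htri i u hu j w hw)
      _ = _ := by
        simp [hB]
        ring

open Classical in
/-- Markov's inequality for the number of vertices in a random set. -/
theorem mul_measureReal_le_card_filter {α V : Type*} [MeasurableSpace α] (μ : Measure α)
    [IsFiniteMeasure μ] [Fintype α] [MeasurableSingletonClass α] (R : Finset V)
    (P : α → V → Prop) (m : ℕ) :
    m * μ.real {a | m ≤ (R.filter (P a)).card} ≤ ∑ v ∈ R, μ.real {a | P a v} := by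
  have hsum : ∀ Q : α → Prop, μ.real {a | Q a} = ∑ a, if Q a then μ.real {a} else 0 := by
    intro Q
    rw [← Finset.sum_filter, sum_measureReal_singleton]
    simp
  simp_rw [hsum]
  rw [Finset.sum_comm, Finset.mul_sum]
  refine Finset.sum_le_sum fun a _ => ?_
  rw [← Finset.sum_filter, Finset.sum_const, nsmul_eq_mul]
  split_ifs with h
  · exact mul_le_mul_of_nonneg_right (by exact_mod_cast h) measureReal_nonneg
  · simpa using mul_nonneg (Nat.cast_nonneg _) measureReal_nonneg

theorem exists_disjoint_blocks {K l : ℕ} (h : K * l ≤ n) :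
    ∃ B : Fin K → Finset (Fin n), (∀ i, (B i).card = l) ∧
      Pairwise fun i j => Disjoint (B i) (B j) := by
  have hinj : Function.Injective fun x : Fin K × Fin l => Fin.castLE h (finProdFinEquiv x) :=
    (Fin.castLE_injective h).comp finProdFinEquiv.injective
  refine ⟨fun i => Finset.univ.image fun j => Fin.castLE h (finProdFinEquiv (i, j)), fun i => ?_,
    fun i j hij => ?_⟩
  · rw [Finset.card_image_of_injective, Finset.card_univ, Fintype.card_fin]
    exact fun a b hab => (Prod.ext_iff.1 (hinj hab)).2
  · refine Finset.disjoint_left.2 ?_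
    intro v hv hv'
    obtain ⟨a, -, rfl⟩ := Finset.mem_image.1 hv
    obtain ⟨b, -, hb⟩ := Finset.mem_image.1 hv'
    exact hij (Prod.ext_iff.1 (hinj hb)).1.symm

/-! ### Lower bound for the expected quality -/

theorem mul_prob_le_erdosRenyiQuality {q : ℝ} (hq0 : 0 ≤ q) (hq1 : q ≤ 1) (τ : TieBreak n)
    (p : I) (E : Set (SimpleGraph (Fin n))) (c : ℝ) (hc : ∀ G ∈ E, c ≤ optimalQuality q τ G) :
    c * (binomialRandom (Fin n) p).real E ≤ erdosRenyiQuality q τ p := by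
  classical
  unfold erdosRenyiQuality
  have hE : (binomialRandom (Fin n) p).real E =
      ∑ G, if G ∈ E then (binomialRandom (Fin n) p).real {G} else 0 := by
    rw [← Finset.sum_filter, sum_measureReal_singleton]
    simp
  rw [hE, Finset.mul_sum]
  refine Finset.sum_le_sum fun G _ => ?_
  split_ifs with h
  · rw [mul_comm]
    exact mul_le_mul_of_nonneg_left (hc G h) measureReal_nonneg
  · rw [mul_zero]
    exact mul_nonneg measureReal_nonneg (optimalQuality_nonneg hq0 hq1 τ G)

theorem erdosRenyiQuality_le_one {q : ℝ} (hq0 : 0 ≤ q) (hq1 : q ≤ 1) (τ : TieBreak n)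
    (p : I) : erdosRenyiQuality q τ p ≤ 1 := by
  unfold erdosRenyiQuality
  calc _ ≤ ∑ G : SimpleGraph (Fin n), (binomialRandom (Fin n) p).real {G} :=
        Finset.sum_le_sum fun G _ =>
          mul_le_of_le_one_right measureReal_nonneg (optimalQuality_le_one hq0 hq1 τ G)
    _ = 1 := by
      rw [sum_measureReal_singleton, Finset.coe_univ, probReal_univ]

/-- The factors are the share of agents reached, the quality at the source `v`, and the probability
that the graph expands and has fewer than `m` bad vertices (by Markov). -/
theorem le_erdosRenyiQuality {q : ℝ} (hq : 1 / 2 < q) (hq1 : q < 1) (τ : TieBreak n) (p : I)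
    {K l k m : ℕ} (hm : 0 < m) (h₁ : K * l + m + k ≤ n) (h₂ : K * l + 2 * k ≤ n) :
    ((n - K * l - 2 * k : ℝ) / n) * (1 - (1 / 2 + 2 * q * (1 - q)) ^ K) *
      (1 - 4 ^ n * (1 - p : ℝ) ^ k ^ 2 -
        n * (K * (1 - p : ℝ) ^ l + (K * l) ^ 2 * (p : ℝ) ^ 3) / m) ≤ erdosRenyiQuality q τ p := by
  classical
  obtain ⟨B, hBcard, hB⟩ := exists_disjoint_blocks (n := n) (K := K) (l := l) (by omega)
  set U := Finset.univ.biUnion B with hU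
  have hUcard : U.card = K * l := by
    rw [hU, Finset.card_biUnion fun i _ j _ hij => hB hij]
    simp [hBcard]
  set μ := binomialRandom (Fin n) p
  let F : Set (SimpleGraph (Fin n)) := {G | m ≤ (Uᶜ.filter (IsBad B G)).card}
  have hF : μ.real F ≤ n * (K * (1 - p : ℝ) ^ l + (K * l) ^ 2 * (p : ℝ) ^ 3) / m := by
    rw [le_div_iff₀' (by exact_mod_cast hm)]
    refine (mul_measureReal_le_card_filter μ Uᶜ (IsBad B) m).trans ?_
    have hp := sub_nonneg.2 p.2.2
    have hp0 := p.2.1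
    calc _ ≤ ∑ _v ∈ Uᶜ, (K * (1 - p : ℝ) ^ l + (K * l) ^ 2 * (p : ℝ) ^ 3) :=
          Finset.sum_le_sum fun v hv => binomialRandom_real_isBad_le p B hBcard v fun i hi =>
            Finset.mem_compl.1 hv (Finset.mem_biUnion.2 ⟨i, Finset.mem_univ i, hi⟩)
      _ ≤ ∑ _v : Fin n, (K * (1 - p : ℝ) ^ l + (K * l) ^ 2 * (p : ℝ) ^ 3) :=
          Finset.sum_le_sum_of_subset_of_nonneg (Finset.subset_univ _) fun _ _ _ => by positivity
      _ = _ := by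
        rw [Finset.sum_const, Finset.card_univ, Fintype.card_fin, nsmul_eq_mul]
  have hE : 1 - 4 ^ n * (1 - p : ℝ) ^ k ^ 2 -
      n * (K * (1 - p : ℝ) ^ l + (K * l) ^ 2 * (p : ℝ) ^ 3) / m ≤
        μ.real ({G | ¬ Expanding G k} ∪ F)ᶜ := by
    rw [probReal_compl_eq_one_sub .of_discrete]
    have := measureReal_union_le (μ := μ) {G | ¬ Expanding G k} F
    have := binomialRandom_real_not_expanding_le (n := n) p k
    linarith
  refine le_trans (mul_le_mul_of_nonneg_left hE (mul_nonneg (div_nonneg ?_ n.cast_nonneg) ?_))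
    (mul_prob_le_erdosRenyiQuality (by linarith) hq1.le τ p _ _ fun G hG => ?_)
  · have : ((K * l + 2 * k : ℕ) : ℝ) ≤ n := by exact_mod_cast h₂
    push_cast at this
    linarith
  · exact sub_nonneg.2 (pow_le_one₀ (by nlinarith) (by nlinarith))
  · simp only [Set.mem_compl_iff, Set.mem_union, Set.mem_ofPred_eq, not_or, not_not, F,
      not_le] at hG
    have h := le_optimalQuality_of_expanding hq hq1 τ G U (Uᶜ.filter (IsBad B G)) k K hG.1
      (fun v hvU hvD => exists_independent_of_not_isBad hB fun hbad =>
        hvD (Finset.mem_filter.2 ⟨Finset.mem_compl.2 hvU, hbad⟩)) (by omega)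
    rw [hUcard] at h
    exact_mod_cast h

/-- The numerical estimate: for suitable parameters, all the error terms are small. -/
theorem le_erdosRenyiQuality_of_large {q ε L : ℝ} (hq : 1 / 2 < q) (hq1 : q < 1) (τ : TieBreak n)
    (p : I) {K : ℕ} (hε : 0 < ε) (hε' : ε ≤ 1 / 20) (hL : 0 < L)
    (hK : (1 / 2 + 2 * q * (1 - q)) ^ K ≤ ε) (hKL : K * Real.exp (-L) ≤ ε) (hp : 0 < (p : ℝ))
    (hp' : (K * (L + 1)) ^ 2 * (p : ℝ) ≤ ε) (hnp₁ : K * (L + 1) ≤ ε * (n * p))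
    (hnp₂ : Real.log 4 + 1 ≤ ε ^ 2 * (n * p)) (hn : Real.exp (-n) ≤ ε) (hn' : 1 ≤ ε * n) :
    1 - 15 * ε ≤ erdosRenyiQuality q τ p := by
  set x := (p : ℝ)
  have hx1 : x ≤ 1 := p.2.2
  have hn20 : (20 : ℝ) ≤ n := by nlinarith
  -- With `l` about `L / x`, a vertex misses a given block with probability at most `exp (-L)`,
  -- while `K l ≤ ε n`.
  obtain ⟨l, hl₁, hl₂⟩ : ∃ l : ℕ, L ≤ x * l ∧ x * l ≤ L + 1 := by
    refine ⟨⌈L / x⌉₊, ?_, ?_⟩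
    · rw [← div_le_iff₀' hp]
      exact Nat.le_ceil _
    · have := (Nat.ceil_lt_add_one (by positivity : 0 ≤ L / x)).le
      calc x * (⌈L / x⌉₊ : ℝ) ≤ x * (L / x + 1) := by gcongr
        _ = L + x := by field_simp
        _ ≤ L + 1 := by linarith
  obtain ⟨k, hk₁, hk₂⟩ : ∃ k : ℕ, ε * n ≤ k ∧ k ≤ 2 * (ε * n) := by
    refine ⟨⌈ε * n⌉₊, Nat.le_ceil _, ?_⟩
    have := (Nat.ceil_lt_add_one (by positivity : 0 ≤ ε * n)).le
    linarith
  -- A constant fraction of bad vertices is tolerable, so `m` can be linear in `n` and Markov loses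
  -- only a factor `4`.
  obtain ⟨m, hm₁, hm₂⟩ : ∃ m : ℕ, (n : ℝ) / 4 ≤ m ∧ (m : ℝ) ≤ n / 4 + 1 :=
    ⟨⌈(n : ℝ) / 4⌉₊, Nat.le_ceil _, (Nat.ceil_lt_add_one (by positivity)).le⟩
  have hKl : (K * l : ℝ) ≤ ε * n := by
    refine le_of_mul_le_mul_right ?_ hp
    calc (K * l * x : ℝ) = K * (x * l) := by ring
      _ ≤ K * (L + 1) := by gcongr
      _ ≤ ε * n * x := by linarith
  have hεn : ε * n ≤ n / 20 := by nlinarith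
  have h₁ : K * l + m + k ≤ n := by
    have : (K * l + m + k : ℝ) ≤ n := by linarith
    exact_mod_cast this
  have h₂ : K * l + 2 * k ≤ n := by
    have : (K * l + 2 * k : ℝ) ≤ n := by linarith
    exact_mod_cast this
  have hm0 : (0 : ℝ) < m := by linarith
  refine le_trans ?_ (le_erdosRenyiQuality hq hq1 τ p (by exact_mod_cast hm0) h₁ h₂)
  have hpow : ∀ j : ℕ, (1 - x) ^ j ≤ Real.exp (-(x * j)) := fun j => by
    calc (1 - x) ^ j ≤ Real.exp (-x) ^ j :=
          pow_le_pow_left₀ (by linarith) (Real.one_sub_le_exp_neg x) j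
      _ = Real.exp (-(x * j)) := by rw [← Real.exp_nat_mul]; ring_nf
  have hA : 1 - 5 * ε ≤ (n - K * l - 2 * k : ℝ) / n := by
    rw [le_div_iff₀ (by linarith)]
    linarith
  -- As `k ≥ ε n`, the exponent `x k^2 ≥ n (ε^2 n x)` beats the entropy `n log 4` by at least `n`.
  have hC : 4 ^ n * (1 - x) ^ k ^ 2 ≤ ε := by
    refine le_trans ?_ hn
    calc 4 ^ n * (1 - x) ^ k ^ 2 ≤ Real.exp (n * Real.log 4) * Real.exp (-(x * (k ^ 2 : ℕ))) := by
          rw [Real.exp_nat_mul, Real.exp_log (by norm_num)]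
          exact mul_le_mul_of_nonneg_left (hpow _) (by positivity)
      _ = Real.exp (n * Real.log 4 - x * (k : ℝ) ^ 2) := by
          rw [← Real.exp_add, Nat.cast_pow, sub_eq_add_neg]
      _ ≤ Real.exp (-n) := by
          refine Real.exp_le_exp.2 ?_
          have hk : x * (ε * n) ^ 2 ≤ x * (k : ℝ) ^ 2 := by gcongr
          have hlog := mul_le_mul_of_nonneg_left hnp₂ (by linarith : (0 : ℝ) ≤ n)
          linarith
  have hD : K * (1 - x) ^ l + (K * l) ^ 2 * x ^ 3 ≤ 2 * ε := by
    have h₃ : K * (1 - x) ^ l ≤ ε := by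
      refine le_trans (mul_le_mul_of_nonneg_left ((hpow l).trans ?_) K.cast_nonneg) hKL
      exact Real.exp_le_exp.2 (by linarith)
    have h₄ : (K * l : ℝ) ^ 2 * x ^ 3 ≤ ε := by
      calc (K * l : ℝ) ^ 2 * x ^ 3 = (K * (x * l)) ^ 2 * x := by ring
        _ ≤ (K * (L + 1)) ^ 2 * x := by gcongr
        _ ≤ ε := hp'
    linarith
  have hD' : n * (K * (1 - x) ^ l + (K * l) ^ 2 * x ^ 3) / m ≤ 8 * ε := by
    rw [div_le_iff₀ hm0]
    calc n * (K * (1 - x) ^ l + (K * l) ^ 2 * x ^ 3) ≤ n * (2 * ε) := by gcongr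
      _ ≤ 8 * ε * m := by nlinarith
  -- The losses are `5ε = ε + 2 * 2ε` from `K l` and `2 k`, `ε` from the majority, and `9ε = ε + 8ε`
  -- from expansion and bad vertices.
  calc 1 - 15 * ε ≤ (1 - 5 * ε) * (1 - ε) * (1 - 9 * ε) := by nlinarith [sq_nonneg ε]
    _ ≤ _ := by
      refine mul_le_mul (mul_le_mul hA (by linarith) (by linarith) ?_) (by linarith) (by linarith)
        (mul_nonneg ?_ (by linarith)) <;> linarith

end SocialLearning

end

theorem mainTheorem3 (q : ℝ) (hq : 1 / 2 < q) (hq1 : q < 1) (p : ℕ → unitInterval)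
    (hp_upper : (fun n : ℕ => (n : ℝ) * (p n : ℝ)) =o[atTop] (fun n : ℕ => (n : ℝ)))
    (hp_lower : Tendsto (fun n : ℕ => (n : ℝ) * (p n : ℝ)) atTop atTop) :
    SocialLearning.AchievesTruthLearning q p := by
  intro τ
  have hq0 : 0 ≤ q := by linarith
  have hp : Tendsto (fun n => (p n : ℝ)) atTop (𝓝 0) := by
    refine hp_upper.tendsto_div_nhds_zero.congr' ?_
    filter_upwards [eventually_gt_atTop 0] with n hn
    exact mul_div_cancel_left₀ _ (by positivity)
  refine tendsto_order.2 ⟨fun a ha => ?_, fun a ha => .of_forall fun n =>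
    (SocialLearning.erdosRenyiQuality_le_one hq0 hq1.le (τ n) (p n)).trans_lt ha⟩
  obtain ⟨ε, hε, hε', hεa⟩ : ∃ ε : ℝ, 0 < ε ∧ ε ≤ 1 / 20 ∧ a < 1 - 15 * ε := by
    refine ⟨min (1 / 20) ((1 - a) / 16), lt_min (by norm_num) (by linarith), min_le_left _ _, ?_⟩
    have := min_le_right (1 / 20) ((1 - a) / 16)
    linarith
  -- The order of choice matters: `K` depends on `ε` and `q`, `L` on `K`, and only then is `n` taken
  -- large. `p → 0` removes triangles; `n p → ∞` gives expansion and small blocks.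
  obtain ⟨K, hK⟩ := exists_pow_lt_of_lt_one hε
    (by nlinarith [sq_pos_of_pos (sub_pos.2 hq)] : 1 / 2 + 2 * q * (1 - q) < 1)
  obtain ⟨L, hKL, hL⟩ : ∃ L : ℝ, K * Real.exp (-L) < ε ∧ 0 < L := by
    have h : Tendsto (fun L : ℝ => K * Real.exp (-L)) atTop (𝓝 0) := by
      simpa using Real.tendsto_exp_neg_atTop_nhds_zero.const_mul (K : ℝ)
    exact ((h.eventually_lt_const hε).and (eventually_gt_atTop 0)).exists
  have h₁ : ∀ᶠ n : ℕ in atTop, (K * (L + 1)) ^ 2 * (p n : ℝ) < ε := by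
    have h := hp.const_mul ((K * (L + 1)) ^ 2)
    rw [mul_zero] at h
    exact h.eventually_lt_const hε
  have h₂ := (hp_lower.const_mul_atTop hε).eventually_ge_atTop (K * (L + 1))
  have h₃ := (hp_lower.const_mul_atTop (pow_pos hε 2)).eventually_ge_atTop (Real.log 4 + 1)
  have h₄ := (Real.tendsto_exp_neg_atTop_nhds_zero.comp
    (tendsto_natCast_atTop_atTop (R := ℝ))).eventually_lt_const hε
  have h₅ := ((tendsto_natCast_atTop_atTop (R := ℝ)).const_mul_atTop hε).eventually_ge_atTop 1
  filter_upwards [h₁, h₂, h₃, h₄, h₅, hp_lower.eventually_gt_atTop 0] with n h₁ h₂ h₃ h₄ h₅ h₆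
  exact hεa.trans_le (SocialLearning.le_erdosRenyiQuality_of_large hq hq1 (τ n) (p n) hε hε' hL
    hK.le hKL.le (pos_of_mul_pos_right h₆ n.cast_nonneg) h₁.le h₂ h₃ h₄.le h₅)
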